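/- **Theorem 3.2.** Let $p$ be a prime, let $h_1,h_2\ge 1$ be relatively prime integers, and let $\overline{\mathbb Q}_p$ be an algebraic closure of $\mathbb Q_p$, with $p$-adic absolute value $|\cdot|$. Let $L=(L_1,L_2)\in\mathbb Q_p[[x_1,x_2]]^2$ be the unique pair of power series satisfying $$L_1(x_1,x_2)=x_1+p^{-1}L_2\big(x_1^{p^{h_1}},x_2^{p^{h_1}}\big),\qquad L_2(x_1,x_2)=x_2+p^{-1}L_1\big(x_1^{p^{h_2}},x_2^{p^{h_2}}\big),$$ let $L^{-1}$ be its inverse for composition, and let $F(X,Y)=L^{-1}(L(X)+L(Y))$ be the associated two-dimensional Lubin–Tate formal group over $\mathbb Z_p$. Put $[1]_F(X)=X$ and $[k]_F(X)=F(X,[k-1]_F(X))$ for $k\ge 2$. Then for every $n\ge 1$, every solution $\alpha=(\alpha_1,\alpha_2)\in\overline{\mathbb Q}_p^{\,2}$, $|\alpha_1|<1$, $|\alpha_2|<1$, of $[p^n]_F(X)=\vec 0$ has multiplicity one, that is, writing $[p^n]_F=(f_1,f_2)$, $$\dim_{\overline{\mathbb Q}_p}\ \overline{\mathbb Q}_p[[x_1,x_2]]\big/\big(f_1(\alpha+X),\,f_2(\alpha+X)\big)=1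 .$$ Moreover, at every such $\alpha$ the Jacobian matrix of $[p]_F$ is invertible over $\overline{\mathbb Q}_p$. -/

import Mathlib

open MvPowerSeries

namespace LubinTate2

/-! ### Tuples of formal power series without constant term, and fixed points -/

section Tuples

variable {K : Type*} [Field K]

/-- The formal inverse for composition of a pair `L` of power series: a pair `M` without constant
terms such that `L(M(X)) = X = M(L(X))`. -/
def IsCompInverse (L M : Fin 2 → MvPowerSeries (Fin 2) K) : Prop :=
  (∀ i, constantCoeff (M i) = 0) ∧ (∀ i, (L i).subst M = X i) ∧ (∀ i, (M i).subst L = X i)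

/-- A map on pairs of power series without constant term which is contracting for the adic
topology has a unique fixed point. -/
theorem existsUnique_fixed
    (Φ : (Fin 2 → MvPowerSeries (Fin 2) K) → (Fin 2 → MvPowerSeries (Fin 2) K))
    (h0 : ∀ a, (∀ i, 1 ≤ (a i).order) → ∀ i, 1 ≤ (Φ a i).order)
    (hc : ∀ (n : ℕ) (a b : Fin 2 → MvPowerSeries (Fin 2) K), 1 ≤ n →
      (∀ i, 1 ≤ (a i).order) → (∀ i, 1 ≤ (b i).order) →
      (∀ i, (n : ℕ∞) ≤ (a i - b i).order) → ∀ i, ((n + 1 : ℕ) : ℕ∞) ≤ (Φ a i - Φ b i).order) :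
    ∃! a : Fin 2 → MvPowerSeries (Fin 2) K, (∀ i, 1 ≤ (a i).order) ∧ Φ a = a := by
  set s : ℕ → Fin 2 → MvPowerSeries (Fin 2) K := fun n => Φ^[n] 0 with hs
  have hs1 : ∀ n, s (n + 1) = Φ (s n) := fun n => Function.iterate_succ_apply' Φ n 0
  have hs0 : ∀ n i, 1 ≤ (s n i).order := by
    intro n
    induction n with
    | zero => intro i; simp [hs]
    | succ n ih => rw [hs1]; exact h0 _ ih
  have sub_order : ∀ (n : ℕ∞) (f g h : MvPowerSeries (Fin 2) K), n ≤ (f - g).order →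
      n ≤ (g - h).order → n ≤ (f - h).order := by
    intro n f g h h1 h2
    have : f - h = (f - g) + (g - h) := by ring
    rw [this]
    exact (le_min h1 h2).trans min_order_le_add
  have sub_one : ∀ (f g : MvPowerSeries (Fin 2) K), 1 ≤ f.order → 1 ≤ g.order →
      1 ≤ (f - g).order := by
    intro f g h1 h2
    apply sub_order 1 f 0 g (by simpa using h1)
    rw [zero_sub, order_neg]; exact h2
  have step : ∀ n i, ((n + 1 : ℕ) : ℕ∞) ≤ (s (n + 1) i - s n i).order := by
    intro n
    induction n with
    | zero => intro i; simpa using sub_one _ _ (hs0 1 i) (hs0 0 i)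
    | succ n ih =>
      intro i
      rw [hs1 (n + 1), show Φ (s (n + 1)) i - s (n + 1) i = Φ (s (n + 1)) i - Φ (s n) i by rw [hs1]]
      exact hc (n + 1) _ _ (by omega) (hs0 _) (hs0 _) ih i
  have stepk : ∀ n k i, ((n + 1 : ℕ) : ℕ∞) ≤ (s (n + k) i - s n i).order := by
    intro n k i
    induction k with
    | zero => simp
    | succ k ih =>
      refine sub_order _ _ (s (n + k) i) _ (le_trans ?_ (step (n + k) i)) ih
      exact_mod_cast (by omega)
  let a : Fin 2 → MvPowerSeries (Fin 2) K := fun i d => coeff d (s d.degree i)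
  have ha : ∀ i d, coeff d (a i) = coeff d (s d.degree i) := fun i d => rfl
  have hlim : ∀ n i, ((n + 1 : ℕ) : ℕ∞) ≤ (a i - s n i).order := by
    intro n i
    apply nat_le_order
    intro d hd
    have h1 := stepk d.degree (n - d.degree) i
    rw [Nat.add_sub_cancel' (by omega)] at h1
    have h2 := coeff_of_lt_order (lt_of_lt_of_le (by exact_mod_cast Nat.lt_succ_self _) h1)
    rw [map_sub, sub_eq_zero] at h2
    rw [map_sub, ha, h2, sub_self]
  have ha1 : ∀ i, 1 ≤ (a i).order := by
    intro i
    have := sub_order 1 (a i) (s 0 i) 0 (by simpa using hlim 0 i) (by simpa using hs0 0 i)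
    simpa using this
  have eq_of : ∀ f g : MvPowerSeries (Fin 2) K, (∀ n : ℕ, ((n + 1 : ℕ) : ℕ∞) ≤ (f - g).order) →
      f = g := by
    intro f g h
    rw [← sub_eq_zero]
    ext d
    rw [coeff_of_lt_order (lt_of_lt_of_le (by exact_mod_cast Nat.lt_succ_self _) (h d.degree))]
    simp
  refine ⟨a, ⟨ha1, ?_⟩, ?_⟩
  · funext i
    apply eq_of
    intro n
    refine sub_order _ _ (s (n + 1) i) _ ?_ ?_
    · rw [hs1]
      exact le_trans (by exact_mod_cast (by omega))
        (hc (n + 1) _ _ (by omega) ha1 (hs0 n) (hlim n) i)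
    · rw [← order_neg, neg_sub]
      exact le_trans (by exact_mod_cast (by omega)) (hlim (n + 1) i)
  · rintro b ⟨hb1, hb⟩
    funext i
    apply eq_of
    intro n
    revert i
    induction n with
    | zero => intro i; simpa using sub_one _ _ (hb1 i) (ha1 i)
    | succ n ih =>
      intro i
      have hfa : Φ a = a := by
        funext i
        apply eq_of
        intro n
        refine sub_order _ _ (s (n + 1) i) _ ?_ ?_
        · rw [hs1]
          exact le_trans (by exact_mod_cast (by omega))
            (hc (n + 1) _ _ (by omega) ha1 (hs0 n) (hlim n) i)
        · rw [← order_neg, neg_sub]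
          exact le_trans (by exact_mod_cast (by omega)) (hlim (n + 1) i)
      have := hc (n + 1) _ _ (by omega) hb1 ha1 ih i
      rwa [hb, hfa] at this

theorem order_pow_sub_pow {a b : MvPowerSeries (Fin 2) K} {n : ℕ} (ha : 1 ≤ a.order)
    (hb : 1 ≤ b.order) (hab : (n : ℕ∞) ≤ (a - b).order) (k : ℕ) :
    ((n + k : ℕ) : ℕ∞) ≤ (a ^ (k + 1) - b ^ (k + 1)).order := by
  induction k with
  | zero => simpa using hab
  | succ k ih =>
    have e : a ^ (k + 1 + 1) - b ^ (k + 1 + 1) =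
        a ^ (k + 1) * (a - b) + (a ^ (k + 1) - b ^ (k + 1)) * b := by ring
    have hp : ((k + 1 : ℕ) : ℕ∞) ≤ (a ^ (k + 1)).order :=
      le_order_pow_of_constantCoeff_eq_zero _ (one_le_order_iff_constCoeff_eq_zero.mp ha)
    rw [e]
    refine (le_min ?_ ?_).trans min_order_le_add
    · refine le_trans ?_ le_order_mul
      calc ((n + (k + 1) : ℕ) : ℕ∞) = ((k + 1 : ℕ) : ℕ∞) + n := by push_cast; ring
        _ ≤ _ := add_le_add hp hab
    · refine le_trans ?_ le_order_mul
      calc ((n + (k + 1) : ℕ) : ℕ∞) = ((n + k : ℕ) : ℕ∞) + 1 := by push_cast; ring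
        _ ≤ _ := add_le_add ih hb

theorem order_monomial_sub {a b : Fin 2 → MvPowerSeries (Fin 2) K} {n : ℕ}
    (ha : ∀ i, 1 ≤ (a i).order) (hb : ∀ i, 1 ≤ (b i).order)
    (hab : ∀ i, (n : ℕ∞) ≤ (a i - b i).order) (u v : ℕ) (huv : 2 ≤ u + v) :
    ((n + 1 : ℕ) : ℕ∞) ≤ (a 0 ^ u * a 1 ^ v - b 0 ^ u * b 1 ^ v).order := by
  have e : a 0 ^ u * a 1 ^ v - b 0 ^ u * b 1 ^ v =
      a 0 ^ u * (a 1 ^ v - b 1 ^ v) + (a 0 ^ u - b 0 ^ u) * b 1 ^ v := by ring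
  have hpa : ∀ k : ℕ, (k : ℕ∞) ≤ (a 0 ^ k).order := fun k =>
    le_order_pow_of_constantCoeff_eq_zero _ (one_le_order_iff_constCoeff_eq_zero.mp (ha 0))
  have hpb : ∀ k : ℕ, (k : ℕ∞) ≤ (b 1 ^ k).order := fun k =>
    le_order_pow_of_constantCoeff_eq_zero _ (one_le_order_iff_constCoeff_eq_zero.mp (hb 1))
  rw [e]
  refine (le_min ?_ ?_).trans min_order_le_add
  · rcases v with _ | v
    · simp
    · refine le_trans ?_ le_order_mul
      refine le_trans ?_ (add_le_add (hpa u) (order_pow_sub_pow (ha 1) (hb 1) (hab 1) v))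
      exact_mod_cast (by omega)
  · rcases u with _ | u
    · simp
    · refine le_trans ?_ le_order_mul
      refine le_trans ?_ (add_le_add (order_pow_sub_pow (ha 0) (hb 0) (hab 0) u) (hpb v))
      exact_mod_cast (by omega)

theorem hasSubst_of_order {a : Fin 2 → MvPowerSeries (Fin 2) K} (ha : ∀ i, 1 ≤ (a i).order) :
    HasSubst a :=
  hasSubst_of_constantCoeff_zero fun i => one_le_order_iff_constCoeff_eq_zero.mp (ha i)

theorem order_subst_sub_subst {N : MvPowerSeries (Fin 2) K} (hN : 2 ≤ N.order)
    {a b : Fin 2 → MvPowerSeries (Fin 2) K} {n : ℕ}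
    (ha : ∀ i, 1 ≤ (a i).order) (hb : ∀ i, 1 ≤ (b i).order)
    (hab : ∀ i, (n : ℕ∞) ≤ (a i - b i).order) :
    ((n + 1 : ℕ) : ℕ∞) ≤ (N.subst a - N.subst b).order := by
  apply nat_le_order
  intro d hd
  rw [map_sub, sub_eq_zero, coeff_subst (hasSubst_of_order ha), coeff_subst (hasSubst_of_order hb)]
  refine finsum_congr fun e => ?_
  by_cases he : e.degree < 2
  · rw [coeff_of_lt_order (lt_of_lt_of_le (by exact_mod_cast he) hN)]; simp
  · have he' : 2 ≤ e 0 + e 1 := by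
      have : e.degree = e 0 + e 1 := by
        rw [Finsupp.degree_eq_sum]; simp
      omega
    have h1 : ∀ c : Fin 2 → MvPowerSeries (Fin 2) K,
        (e.prod fun s e => c s ^ e) = c 0 ^ e 0 * c 1 ^ e 1 := by
      intro c
      rw [Finsupp.prod_fintype _ _ (by simp)]; simp
    have h2 := coeff_of_lt_order
      (lt_of_lt_of_le (by exact_mod_cast hd) (order_monomial_sub ha hb hab _ _ he') :
        ((d.degree : ℕ) : ℕ∞) < _)
    rw [map_sub, sub_eq_zero] at h2
    rw [h1, h1, h2]

theorem le_order_sub {f g : MvPowerSeries (Fin 2) K} {n : ℕ∞} (hf : n ≤ f.order)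
    (hg : n ≤ g.order) : n ≤ (f - g).order := by
  rw [sub_eq_add_neg]
  exact (le_min hf (by rwa [order_neg])).trans min_order_le_add

theorem le_order_add {f g : MvPowerSeries (Fin 2) K} {n : ℕ∞} (hf : n ≤ f.order)
    (hg : n ≤ g.order) : n ≤ (f + g).order :=
  (le_min hf hg).trans min_order_le_add

theorem one_le_order_X (i : Fin 2) : 1 ≤ (X i : MvPowerSeries (Fin 2) K).order :=
  one_le_order_iff_constCoeff_eq_zero.mpr (by simp)

theorem one_le_order_of_sub_X {f : MvPowerSeries (Fin 2) K} {i : Fin 2}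
    (hf : 2 ≤ (f - X i).order) : 1 ≤ f.order := by
  have := le_order_add (n := 1) (le_trans (by norm_num) hf) (one_le_order_X (K := K) i)
  simpa using this

theorem le_order_subst_of {N : MvPowerSeries (Fin 2) K} {n : ℕ∞} (hN : n ≤ N.order)
    {a : Fin 2 → MvPowerSeries (Fin 2) K} (ha : ∀ i, 1 ≤ (a i).order) :
    n ≤ (N.subst a).order := by
  refine le_trans ?_ (le_order_subst (hasSubst_of_order ha) N)
  calc n = 1 * n := (one_mul n).symm
    _ ≤ _ := mul_le_mul' (le_iInf ha) hN

/-- A pair congruent to `X` modulo degree two has a right inverse of the same kind. -/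
theorem exists_rightInverse (L : Fin 2 → MvPowerSeries (Fin 2) K)
    (hL : ∀ i, 2 ≤ (L i - X i).order) :
    ∃ M : Fin 2 → MvPowerSeries (Fin 2) K, (∀ i, 2 ≤ (M i - X i).order) ∧
      ∀ i, (L i).subst M = X i := by
  obtain ⟨M, ⟨hM, hfix⟩, -⟩ := existsUnique_fixed
    (fun a i => X i - (L i - X i).subst a)
    (fun a ha i => le_order_sub (one_le_order_X i)
      (le_order_subst_of (le_trans (by norm_num) (hL i)) ha))
    (fun n a b _ ha hb hab i => by
      have := order_subst_sub_subst (hL i) ha hb hab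
      rw [← order_neg, neg_sub] at this
      show _ ≤ ((X i - (L i - X i).subst a) - (X i - (L i - X i).subst b)).order
      rwa [sub_sub_sub_cancel_left])
  have hM' : ∀ i, M i = X i - (L i - X i).subst M := fun i => (congrFun hfix i).symm
  refine ⟨M, fun i => ?_, fun i => ?_⟩
  · have h := le_order_subst_of (hL i) hM
    rw [← order_neg] at h
    have e : M i - X i = -(L i - X i).subst M := by
      conv_lhs => rw [hM' i]
      ring
    rwa [e]
  · have h := hM' i
    rw [subst_sub (hasSubst_of_order hM), subst_X (hasSubst_of_order hM)] at h
    linear_combination h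

/-- A pair congruent to `X` modulo degree two has a unique inverse for composition. -/
theorem existsUnique_compInverse (L : Fin 2 → MvPowerSeries (Fin 2) K)
    (hL : ∀ i, 2 ≤ (L i - X i).order) : ∃! M, IsCompInverse L M := by
  obtain ⟨M, hM, hLM⟩ := exists_rightInverse L hL
  obtain ⟨P, hP, hMP⟩ := exists_rightInverse M hM
  have sM := hasSubst_of_order fun i => one_le_order_of_sub_X (hM i)
  have sP := hasSubst_of_order fun i => one_le_order_of_sub_X (hP i)
  have hPL : P = L := by
    funext i
    calc P i = (X i : MvPowerSeries (Fin 2) K).subst P := (subst_X sP i).symm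
      _ = ((L i).subst M).subst P := by rw [hLM]
      _ = (L i).subst (fun j => (M j).subst P) := subst_comp_subst_apply sM sP _
      _ = (L i).subst X := by simp_rw [hMP]
      _ = L i := by rw [subst_self]; rfl
  subst hPL
  refine ⟨M, ⟨fun i => one_le_order_iff_constCoeff_eq_zero.mp (one_le_order_of_sub_X (hM i)),
    hLM, hMP⟩, ?_⟩
  rintro M' ⟨h0, h1, -⟩
  have sM' : HasSubst M' := hasSubst_of_constantCoeff_zero h0
  funext i
  calc M' i = (X i : MvPowerSeries (Fin 2) K).subst M' := (subst_X sM' i).symm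
    _ = ((M i).subst P).subst M' := by rw [hMP]
    _ = (M i).subst (fun j => (P j).subst M') := subst_comp_subst_apply sP sM' _
    _ = (M i).subst X := by simp_rw [h1]
    _ = M i := by rw [subst_self]; rfl

end Tuples

/-! ### The logarithm -/

section Logarithm

variable (p : ℕ) [Fact p.Prime] (h₁ h₂ : ℕ+)

/-- The family of matrices `s_k`: `s_{h₁} = (0, 1/p; 0, 0)`, `s_{h₂} = (0, 0; 1/p, 0)` and
`s_k = 0` otherwise (if `h₁ = h₂`, the two matrices are added). -/
noncomputable def typeMatrix (k : ℕ) : Matrix (Fin 2) (Fin 2) ℚ_[p] :=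
  (if k = h₁ then !![0, (p : ℚ_[p])⁻¹; 0, 0] else 0) +
    (if k = h₂ then !![0, 0; (p : ℚ_[p])⁻¹, 0] else 0)

/-- The functional equation `L(X) = X + ∑_{k ≥ 1} s_k L(X^{p^k})` for a pair of power series over
`ℚ_p`, where `L(X^q)` is obtained by `x_j ↦ x_j ^ q`; only `k = h₁` and `k = h₂` contribute. -/
def IsLogarithm (L : Fin 2 → MvPowerSeries (Fin 2) ℚ_[p]) : Prop :=
  ∀ i, L i = X i + ∑ k ∈ ({(h₁ : ℕ), (h₂ : ℕ)} : Finset ℕ), ∑ j,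
    typeMatrix p h₁ h₂ k i j •
      expand (p ^ k) (pow_ne_zero k (Fact.out : p.Prime).ne_zero) (L j)

/-- The functional equation written out in coordinates:
`L₁(X) = x₁ + p⁻¹ L₂(X^{p^{h₁}})` and `L₂(X) = x₂ + p⁻¹ L₁(X^{p^{h₂}})`. -/
theorem isLogarithm_iff (L : Fin 2 → MvPowerSeries (Fin 2) ℚ_[p]) :
    IsLogarithm p h₁ h₂ L ↔
      L 0 = X 0 + (p : ℚ_[p])⁻¹ •
        expand (p ^ (h₁ : ℕ)) (pow_ne_zero _ (Fact.out : p.Prime).ne_zero) (L 1) ∧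
      L 1 = X 1 + (p : ℚ_[p])⁻¹ •
        expand (p ^ (h₂ : ℕ)) (pow_ne_zero _ (Fact.out : p.Prime).ne_zero) (L 0) := by
  unfold IsLogarithm
  rw [Fin.forall_fin_two]
  by_cases h : (h₁ : ℕ) = h₂
  · simp [typeMatrix, h]
  · simp [typeMatrix, h, Ne.symm h, Finset.sum_pair h]

theorem order_expand_step {n : ℕ} (hn : 1 ≤ n) (k : ℕ+) {f : MvPowerSeries (Fin 2) ℚ_[p]}
    (hf : (n : ℕ∞) ≤ f.order) (c : ℚ_[p]) :
    ((n + 1 : ℕ) : ℕ∞) ≤ (c • expand (p ^ (k : ℕ))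
      (pow_ne_zero _ (Fact.out : p.Prime).ne_zero) f).order := by
  refine le_trans ?_ le_order_smul
  rw [order_expand]
  have hq : 2 ≤ p ^ (k : ℕ) :=
    (Fact.out : p.Prime).two_le.trans (Nat.le_self_pow k.ne_zero p)
  calc ((n + 1 : ℕ) : ℕ∞) ≤ ((p ^ (k : ℕ) * n : ℕ) : ℕ∞) := by
        exact_mod_cast (by nlinarith)
    _ = (p ^ (k : ℕ)) • (n : ℕ∞) := by simp
    _ ≤ _ := by gcongr

theorem IsLogarithm.constantCoeff_eq_zero {L : Fin 2 → MvPowerSeries (Fin 2) ℚ_[p]}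
    (hL : IsLogarithm p h₁ h₂ L) (i : Fin 2) : constantCoeff (L i) = 0 := by
  obtain ⟨h0, h1⟩ := (isLogarithm_iff p h₁ h₂ L).mp hL
  have hp0 : (p : ℚ_[p]) ≠ 0 := by exact_mod_cast (Fact.out : p.Prime).ne_zero
  have c0 := congrArg constantCoeff h0
  have c1 := congrArg constantCoeff h1
  simp only [map_add, constantCoeff_X, zero_add, constantCoeff_smul, constantCoeff_expand,
    smul_eq_mul] at c0 c1
  have hpp : (p : ℚ_[p]) * p - 1 ≠ 0 := by
    have : 1 < p * p := by nlinarith [(Fact.out : p.Prime).two_le]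
    rw [sub_ne_zero]
    exact_mod_cast this.ne'
  have c0' : (p : ℚ_[p]) * constantCoeff (L 0) = constantCoeff (L 1) := by
    conv_lhs => rw [c0]
    rw [mul_inv_cancel_left₀ hp0]
  have c1' : (p : ℚ_[p]) * constantCoeff (L 1) = constantCoeff (L 0) := by
    conv_lhs => rw [c1]
    rw [mul_inv_cancel_left₀ hp0]
  have z0 : constantCoeff (L 0) = 0 := by
    have : ((p : ℚ_[p]) * p - 1) * constantCoeff (L 0) = 0 := by
      linear_combination (p : ℚ_[p]) * c0' + c1'
    exact (mul_eq_zero.mp this).resolve_left hpp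
  fin_cases i
  · exact z0
  · show constantCoeff (L 1) = 0
    rw [← c0', z0, mul_zero]

theorem existsUnique_logarithm : ∃! L, IsLogarithm p h₁ h₂ L := by
  obtain ⟨L, ⟨hL, hfix⟩, huniq⟩ := existsUnique_fixed
    (fun (a : Fin 2 → MvPowerSeries (Fin 2) ℚ_[p]) => ![
      X 0 + (p : ℚ_[p])⁻¹ • expand (p ^ (h₁ : ℕ))
        (pow_ne_zero _ (Fact.out : p.Prime).ne_zero) (a 1),
      X 1 + (p : ℚ_[p])⁻¹ • expand (p ^ (h₂ : ℕ))
        (pow_ne_zero _ (Fact.out : p.Prime).ne_zero) (a 0)])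
    (fun a ha i => by
      fin_cases i
      · exact le_order_add (one_le_order_X _) (le_trans (by norm_num)
          (order_expand_step p le_rfl h₁ (by simpa using ha 1) _))
      · exact le_order_add (one_le_order_X _) (le_trans (by norm_num)
          (order_expand_step p le_rfl h₂ (by simpa using ha 0) _)))
    (fun n a b hn ha hb hab i => by
      fin_cases i
      · have := order_expand_step p hn h₁ (hab 1) (p : ℚ_[p])⁻¹
        simpa [smul_sub] using this
      · have := order_expand_step p hn h₂ (hab 0) (p : ℚ_[p])⁻¹
        simpa [smul_sub] using this)
  refine ⟨L, (isLogarithm_iff p h₁ h₂ L).mpr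
    ⟨(congrFun hfix 0).symm, (congrFun hfix 1).symm⟩, ?_⟩
  intro L' hL'
  refine huniq L' ⟨fun i => one_le_order_iff_constCoeff_eq_zero.mpr
    (hL'.constantCoeff_eq_zero p h₁ h₂ i), ?_⟩
  obtain ⟨h0, h1⟩ := (isLogarithm_iff p h₁ h₂ L').mp hL'
  funext i
  fin_cases i
  · exact h0.symm
  · exact h1.symm

/-- The logarithm `L`: the unique solution of the functional equation. -/
noncomputable def logarithm : Fin 2 → MvPowerSeries (Fin 2) ℚ_[p] :=
  (existsUnique_logarithm p h₁ h₂).choose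

theorem isLogarithm_logarithm : IsLogarithm p h₁ h₂ (logarithm p h₁ h₂) :=
  (existsUnique_logarithm p h₁ h₂).choose_spec.1

/-- `L(X) ≡ X` modulo terms of degree two. -/
theorem two_le_order_logarithm_sub_X (i : Fin 2) :
    2 ≤ (logarithm p h₁ h₂ i - X i).order := by
  have hL := isLogarithm_logarithm p h₁ h₂
  have hc := fun j => one_le_order_iff_constCoeff_eq_zero.mpr
    (hL.constantCoeff_eq_zero p h₁ h₂ j)
  obtain ⟨h0, h1⟩ := (isLogarithm_iff p h₁ h₂ _).mp hL
  fin_cases i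
  · have := order_expand_step p le_rfl h₁ (by simpa using hc 1) (p : ℚ_[p])⁻¹
    rw [← sub_eq_iff_eq_add'.mpr h0] at this
    exact this
  · have := order_expand_step p le_rfl h₂ (by simpa using hc 0) (p : ℚ_[p])⁻¹
    rw [← sub_eq_iff_eq_add'.mpr h1] at this
    exact this

/-- The inverse `L⁻¹` of the logarithm for composition of power series. -/
noncomputable def logarithmInv : Fin 2 → MvPowerSeries (Fin 2) ℚ_[p] :=
  (existsUnique_compInverse (logarithm p h₁ h₂) (two_le_order_logarithm_sub_X p h₁ h₂)).choose

theorem isCompInverse_logarithmInv :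
    IsCompInverse (logarithm p h₁ h₂) (logarithmInv p h₁ h₂) :=
  (existsUnique_compInverse (logarithm p h₁ h₂)
    (two_le_order_logarithm_sub_X p h₁ h₂)).choose_spec.1

end Logarithm

/-! ### The formal group and its multiplication maps -/

/-- The two-dimensional Lubin–Tate formal group `F(X, Y) = L⁻¹(L(X) + L(Y))` attached to
`(h₁, h₂)`. The variables `X` are indexed by `Sum.inl` and the variables `Y` by `Sum.inr`.
Its coefficients are `p`-adic integers, viewed here as elements of `ℚ_p`. -/
noncomputable def formalGroup (p : ℕ) [Fact p.Prime] (h₁ h₂ : ℕ+) :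
    Fin 2 → MvPowerSeries (Fin 2 ⊕ Fin 2) ℚ_[p] :=
  fun i => (logarithmInv p h₁ h₂ i).subst fun j =>
    (logarithm p h₁ h₂ j).subst (fun l => (X (Sum.inl l) : MvPowerSeries (Fin 2 ⊕ Fin 2) ℚ_[p])) +
    (logarithm p h₁ h₂ j).subst (fun l => (X (Sum.inr l) : MvPowerSeries (Fin 2 ⊕ Fin 2) ℚ_[p]))

/-- The multiplication maps of a two-dimensional formal group `F`:
`[0](X) = 0`, `[1](X) = X`, `[k](X) = F(X, [k-1](X))` for `k ≥ 2`. -/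
noncomputable def mulMap {K : Type*} [CommRing K] (F : Fin 2 → MvPowerSeries (Fin 2 ⊕ Fin 2) K) :
    ℕ → Fin 2 → MvPowerSeries (Fin 2) K
  | 0 => fun _ => 0
  | 1 => fun i => X i
  | k + 2 => fun i => (F i).subst (Sum.elim (fun l => X l) (mulMap F (k + 1)))

/-! ### Evaluation on the open polydisc, multiplicity of solutions, Jacobian matrix -/

section Evaluation

variable {p : ℕ} [Fact p.Prime]

/-- The term of multidegree `d` of the series `f` at the point `α` of `ℚ̄_p²`. -/
noncomputable def termAt (f : MvPowerSeries (Fin 2) ℚ_[p]) (α : Fin 2 → PadicAlgCl p)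
    (d : Fin 2 →₀ ℕ) : PadicAlgCl p :=
  algebraMap ℚ_[p] (PadicAlgCl p) (coeff d f) * ∏ i, α i ^ d i

/-- The value `f(α)` of a power series at a point where it converges. (A series with coefficients
in `ℤ_p` converges at every point both of whose coordinates have absolute value `< 1`.) -/
noncomputable def evalAt (f : MvPowerSeries (Fin 2) ℚ_[p]) (α : Fin 2 → PadicAlgCl p) :
    PadicAlgCl p :=
  ∑' d, termAt f α d

/-- `α` is a solution of `f(X) = 0` in the open unit polydisc: both coordinates of `α` lie in the
maximal ideal of the ring of integers of `ℚ̄_p`, and both series converge at `α` with sum zero. -/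
def IsSolution (f : Fin 2 → MvPowerSeries (Fin 2) ℚ_[p]) (α : Fin 2 → PadicAlgCl p) : Prop :=
  (∀ i, ‖α i‖ < 1) ∧ ∀ i, HasSum (termAt (f i) α) 0

/-- The Hasse derivative of multidegree `e`:
`∑ c_d X^d ↦ ∑ (d₁ choose e₁) (d₂ choose e₂) c_d X^{d-e}`. -/
noncomputable def hasseDeriv (e : Fin 2 →₀ ℕ) (f : MvPowerSeries (Fin 2) ℚ_[p]) :
    MvPowerSeries (Fin 2) ℚ_[p] :=
  fun d => (∏ i, ((d i + e i).choose (e i) : ℚ_[p])) * coeff (d + e) f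

/-- The Taylor expansion `f(α + X)` of `f` at `α`, a power series over `ℚ̄_p`; its coefficient
at `X^e` is the value at `α` of the Hasse derivative of `f` of multidegree `e`. -/
noncomputable def taylorAt (f : MvPowerSeries (Fin 2) ℚ_[p]) (α : Fin 2 → PadicAlgCl p) :
    MvPowerSeries (Fin 2) (PadicAlgCl p) :=
  fun e => evalAt (hasseDeriv e f) α

/-- The multiplicity of `α` as a solution of `f₁ = f₂ = 0`: the dimension over `ℚ̄_p` of the
quotient of the complete local ring `ℚ̄_p[[x₁, x₂]]` at `α` by the ideal that the expansions
`f₁(α + X)` and `f₂(α + X)` generate. (The value `0` stands for an infinite dimension, or for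
a point that is not a solution.) -/
noncomputable def multiplicity (f : Fin 2 → MvPowerSeries (Fin 2) ℚ_[p])
    (α : Fin 2 → PadicAlgCl p) : ℕ :=
  Module.finrank (PadicAlgCl p)
    (MvPowerSeries (Fin 2) (PadicAlgCl p) ⧸ Ideal.span (Set.range fun i => taylorAt (f i) α))

/-- The Jacobian matrix `(∂f_i/∂x_j (α))_{i,j}`. -/
noncomputable def jacobianAt (f : Fin 2 → MvPowerSeries (Fin 2) ℚ_[p])
    (α : Fin 2 → PadicAlgCl p) : Matrix (Fin 2) (Fin 2) (PadicAlgCl p) :=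
  Matrix.of fun i j => evalAt (pderiv ℚ_[p] j (f i)) α

end Evaluation

end LubinTate2

/-! The multiplication map $G=[k]_F$ satisfies $L(G(X))=kL(X)$ (`logarithm_subst_mulMap`). Write
$JL$ and $JG$ for the Jacobian matrices. The chain rule gives $JL(G)\cdot JG=k\cdot JL$. Although
$L$ has unbounded denominators, $JL$ has entries in $\mathbb Z_p[[x_1,x_2]]$: differentiating
$p^{-1}L_{i+1}(X^q)$ with $q=p^{h_i}$ produces a factor $q$, which absorbs $p^{-1}$
(`FunctionalEquation.norm_mul_coeff_le_one`). The constant term of $JL$ is the identity, and so is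
that of $JL(G)$. If $G$ is integral too, both matrices are invertible over $\mathbb Z_p[[x_1,x_2]]$,
hence at every point of the open polydisc. There $\det JG$ is $k^2$ times a nonzero number, so it
does not vanish for $k\neq 0$ (`FunctionalEquation.isUnit_jacobianAt`).

Evaluation at $\alpha$ is a ring homomorphism on $\mathbb Z_p[[x_1,x_2]]$ (`evalHom`), so the
integrality of $G$ is essential. It follows from the functional equation: $G$ is the fixed point of
a contraction that preserves integral series, because $G(X^q)\equiv G(X)^q$ modulo $p$ and $L$
respects congruences modulo $p$ (`FunctionalEquation.exists_ofInt_eq_of_subst_eq_nsmul`).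

Finally, at a zero with invertible Jacobian the two Taylor expansions generate the maximal ideal of
the local ring, so the quotient is the base field (`finrank_quotient_span_eq_one`). -/

namespace LubinTate2

/-! ### Chain rule for formal substitution -/

section ChainRule

variable {K : Type*} [Field K]

theorem pderiv_order_le {f : MvPowerSeries (Fin 2) K} {n : ℕ} (j : Fin 2)
    (hf : ((n + 1 : ℕ) : ℕ∞) ≤ f.order) : (n : ℕ∞) ≤ (pderiv K j f).order := by
  apply nat_le_order
  intro d hd
  rw [coeff_pderiv, coeff_of_lt_order (lt_of_lt_of_le _ hf), zero_mul]
  rw [map_add, Finsupp.degree_single]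
  exact_mod_cast (by omega)

theorem pderiv_subst_coe (P : MvPolynomial (Fin 2) K) {a : Fin 2 → MvPowerSeries (Fin 2) K}
    (ha : ∀ i, 1 ≤ (a i).order) (j : Fin 2) :
    pderiv K j ((P : MvPowerSeries (Fin 2) K).subst a) =
      ∑ l, (pderiv K l (P : MvPowerSeries (Fin 2) K)).subst a * pderiv K j (a l) := by
  have hs := hasSubst_of_order ha
  induction P using MvPolynomial.induction_on with
  | C c =>
    rw [MvPolynomial.coe_C]
    have : (C c : MvPowerSeries (Fin 2) K).subst a = C c := by
      exact subst_C (S := K) (a := a) c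
    rw [this]
    have h0 : (0 : MvPowerSeries (Fin 2) K).subst a = 0 := by
      rw [← substAlgHom_apply hs, map_zero]
    simp [h0]
  | add P Q hP hQ =>
    simp only [MvPolynomial.coe_add, subst_add hs, map_add, hP, hQ, add_mul,
      Finset.sum_add_distrib]
  | mul_X P i hP =>
    simp only [MvPolynomial.coe_mul, MvPolynomial.coe_X, subst_mul hs, subst_X hs,
      Derivation.leibniz, smul_eq_mul, hP, subst_add hs, pderiv_X, Fin.sum_univ_two]
    have h0 : (0 : MvPowerSeries (Fin 2) K).subst a = 0 := by
      rw [← substAlgHom_apply hs, map_zero]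
    have h1 : (1 : MvPowerSeries (Fin 2) K).subst a = 1 := by
      rw [← substAlgHom_apply hs, map_one]
    fin_cases i
    · simp [h0, h1]; ring
    · simp [h0, h1]; ring

/-- The chain rule for the substitution of power series without constant term. -/
theorem pderiv_subst (f : MvPowerSeries (Fin 2) K) {a : Fin 2 → MvPowerSeries (Fin 2) K}
    (ha : ∀ i, 1 ≤ (a i).order) (j : Fin 2) :
    pderiv K j (f.subst a) = ∑ l, (pderiv K l f).subst a * pderiv K j (a l) := by
  have hs := hasSubst_of_order ha
  ext d
  -- The remainder has order at least `d.degree + 2`; a derivative costs one, so the remainder still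
  -- does not reach the coefficient at `d`, and the polynomial case suffices.
  set P : MvPolynomial (Fin 2) K := truncTotal (d.degree + 2) f with hP
  have hR : ((d.degree + 1 + 1 : ℕ) : ℕ∞) ≤ (f - (P : MvPowerSeries (Fin 2) K)).order := by
    apply nat_le_order
    intro e he
    rw [map_sub, MvPolynomial.coeff_coe, coeff_truncTotal _ he, sub_self]
  have key := congrArg (coeff d) (pderiv_subst_coe P ha j)
  have h1 : coeff d (pderiv K j ((f - (P : MvPowerSeries (Fin 2) K)).subst a)) = 0 :=
    coeff_of_lt_order (lt_of_lt_of_le (by exact_mod_cast Nat.lt_succ_self _)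
      (pderiv_order_le j (le_order_subst_of hR ha)))
  have h2 : ∀ l, coeff d ((pderiv K l (f - (P : MvPowerSeries (Fin 2) K))).subst a * pderiv K j (a l)) = 0 := fun l =>
    coeff_of_lt_order (lt_of_lt_of_le (by exact_mod_cast Nat.lt_succ_self _)
      ((le_order_subst_of (pderiv_order_le l hR) ha).trans
        (le_trans (by simp) le_order_mul)))
  simp only [subst_sub hs, map_sub, sub_mul] at h1 h2
  rw [sub_eq_zero] at h1
  have h3 := fun l => sub_eq_zero.mp (h2 l)
  rw [h1, key]
  simp only [map_sum, h3]

end ChainRule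

/-! ### Regular parameters in the ring of power series -/

section LocalAlgebra

theorem exists_coeff_eq {R : Type*} [Semiring R] (c : (Fin 2 →₀ ℕ) → R) :
    ∃ g : MvPowerSeries (Fin 2) R, ∀ d, coeff d g = c d :=
  ⟨c, fun _ => rfl⟩

variable {K : Type*} [Field K]

/-- Monomials divisible by the first variable go to `a 0`, pure powers of the second to `a 1`. -/
theorem exists_eq_sum_X_mul (f : MvPowerSeries (Fin 2) K) (hf : constantCoeff f = 0) :
    ∃ a : Fin 2 → MvPowerSeries (Fin 2) K, f = ∑ j, a j * X j ∧
      ∀ j, constantCoeff (a j) = coeff (Finsupp.single j 1) f := by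
  classical
  obtain ⟨a₀, h₀⟩ := exists_coeff_eq fun d => coeff (d + Finsupp.single 0 1) f
  obtain ⟨a₁, h₁⟩ := exists_coeff_eq fun d => if d 0 = 0 then coeff (d + Finsupp.single 1 1) f else 0
  have hX : ∀ (g : MvPowerSeries (Fin 2) K) (j : Fin 2) (d : Fin 2 →₀ ℕ), coeff d (g * X j) =
      if 1 ≤ d j then coeff (d - Finsupp.single j 1) g else 0 := by
    intro g j d
    rw [X, coeff_mul_monomial]
    simp
  have hs : ∀ (j : Fin 2) (d : Fin 2 →₀ ℕ), 1 ≤ d j →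
      d - Finsupp.single j 1 + Finsupp.single j 1 = d := fun j d h =>
    tsub_add_cancel_of_le (by simpa using h)
  refine ⟨![a₀, a₁], ?_, ?_⟩
  · ext d
    rw [Fin.sum_univ_two, map_add, hX, hX]
    simp only [Matrix.cons_val_zero, Matrix.cons_val_one]
    rw [h₀, h₁]
    have hd0 : (d - Finsupp.single 1 1 : Fin 2 →₀ ℕ) 0 = d 0 := by simp
    rw [hd0]
    by_cases c0 : 1 ≤ d 0
    · rw [if_pos c0, hs _ _ c0, if_neg (by omega : ¬ d 0 = 0)]
      simp
    · rw [if_neg c0, if_pos (by omega : d 0 = 0), zero_add]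
      by_cases c1 : 1 ≤ d 1
      · rw [if_pos c1, hs _ _ c1]
      · have : d = 0 := by
          ext j; fin_cases j
          · simpa using c0
          · simpa using c1
        rw [if_neg c1, this]
        simpa using hf
  · intro j
    rw [← coeff_zero_eq_constantCoeff_apply]
    fin_cases j
    · simp [h₀]
    · simp [h₁]

/-- Two power series without constant term and with invertible Jacobian matrix at the origin
generate the maximal ideal. -/
theorem span_eq_ker_constantCoeff (g : Fin 2 → MvPowerSeries (Fin 2) K)
    (h0 : ∀ i, constantCoeff (g i) = 0)
    (hJ : IsUnit (Matrix.of fun i j => coeff (Finsupp.single j 1) (g i))) :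
    Ideal.span (Set.range g) = RingHom.ker (constantCoeff (σ := Fin 2) (R := K)) := by
  apply le_antisymm
  · rw [Ideal.span_le]
    rintro _ ⟨i, rfl⟩
    exact h0 i
  choose a ha hc using fun i => exists_eq_sum_X_mul (g i) (h0 i)
  -- Here `g = A X`, and the constant term of `A` is the Jacobian matrix at the origin. So `A` is
  -- invertible over the power series ring, and the variables are combinations of the `g i`.
  set A : Matrix (Fin 2) (Fin 2) (MvPowerSeries (Fin 2) K) := Matrix.of a with hA
  have hU : IsUnit A.det := by
    rw [isUnit_iff_constantCoeff, RingHom.map_det]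
    rw [Matrix.isUnit_iff_isUnit_det] at hJ
    convert hJ using 2
    ext i j
    simp [hA, hc]
  have hX : ∀ j, (X j : MvPowerSeries (Fin 2) K) ∈ Ideal.span (Set.range g) := by
    intro j
    have e : g = A.mulVec X := by
      funext i
      rw [ha i]; rfl
    have e2 : (X : Fin 2 → MvPowerSeries (Fin 2) K) = A⁻¹.mulVec g := by
      rw [e, Matrix.mulVec_mulVec, Matrix.nonsing_inv_mul _ hU, Matrix.one_mulVec]
    rw [e2]
    rw [Matrix.mulVec, dotProduct]
    exact Ideal.sum_mem _ fun i _ =>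
      Ideal.mul_mem_left (Ideal.span (Set.range g)) _ (Ideal.subset_span (Set.mem_range_self i))
  intro f hf
  obtain ⟨b, hb, -⟩ := exists_eq_sum_X_mul f hf
  rw [hb]
  exact Ideal.sum_mem _ fun j _ => Ideal.mul_mem_left _ _ (hX j)

theorem finrank_quotient_span_eq_one (g : Fin 2 → MvPowerSeries (Fin 2) K)
    (h0 : ∀ i, constantCoeff (g i) = 0)
    (hJ : IsUnit (Matrix.of fun i j => coeff (Finsupp.single j 1) (g i))) :
    Module.finrank K (MvPowerSeries (Fin 2) K ⧸ Ideal.span (Set.range g)) = 1 := by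
  rw [span_eq_ker_constantCoeff g h0 hJ]
  let φ : MvPowerSeries (Fin 2) K →ₐ[K] K :=
    AlgHom.mk (constantCoeff (σ := Fin 2) (R := K)) fun r => constantCoeff_C r
  have hφ : Function.Surjective φ := fun r => ⟨C r, constantCoeff_C r⟩
  have := (Ideal.quotientKerAlgEquivOfSurjective hφ).toLinearEquiv.finrank_eq
  rw [Module.finrank_self] at this
  exact this

end LocalAlgebra

/-! ### Integral power series and the Frobenius congruence -/

section Integrality

variable {p : ℕ} [Fact p.Prime]

/-- The extension of scalars from `ℤ_p` to `ℚ_p`. -/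
noncomputable abbrev ofInt : MvPowerSeries (Fin 2) ℤ_[p] →+* MvPowerSeries (Fin 2) ℚ_[p] :=
  map PadicInt.Coe.ringHom

theorem norm_coeff_ofInt_le_one (f : MvPowerSeries (Fin 2) ℤ_[p]) (d : Fin 2 →₀ ℕ) :
    ‖coeff d (ofInt f)‖ ≤ 1 := by
  rw [coeff_map]
  exact PadicInt.norm_le_one (coeff d f)

theorem exists_ofInt_eq {f : MvPowerSeries (Fin 2) ℚ_[p]} (hf : ∀ d, ‖coeff d f‖ ≤ 1) :
    ∃ g : MvPowerSeries (Fin 2) ℤ_[p], ofInt g = f := by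
  obtain ⟨g, hg⟩ := exists_coeff_eq (R := ℤ_[p]) fun d => ⟨coeff d f, hf d⟩
  refine ⟨g, ?_⟩
  ext d
  rw [coeff_map, hg]
  rfl

theorem ofInt_injective : Function.Injective (ofInt (p := p)) := by
  intro f g h
  ext d
  have := congrArg (coeff d) h
  rw [coeff_map, coeff_map] at this
  exact Subtype.coe_injective this

theorem pderiv_ofInt (j : Fin 2) (f : MvPowerSeries (Fin 2) ℤ_[p]) :
    pderiv ℚ_[p] j (ofInt f) = ofInt (pderiv ℤ_[p] j f) := by
  ext d
  simp [coeff_pderiv]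

theorem norm_coeff_le_of_dvd {f : MvPowerSeries (Fin 2) ℤ_[p]} {k : ℕ}
    (h : (p : MvPowerSeries (Fin 2) ℤ_[p]) ^ k ∣ f) (d : Fin 2 →₀ ℕ) :
    ‖coeff d (ofInt f)‖ ≤ ‖(p : ℚ_[p])‖ ^ k := by
  obtain ⟨g, rfl⟩ := h
  rw [map_mul, map_pow, map_natCast, ← map_natCast (C (σ := Fin 2) (R := ℚ_[p])), ← map_pow,
    coeff_C_mul, norm_mul, norm_pow]
  exact mul_le_of_le_one_right (by positivity) (norm_coeff_ofInt_le_one g d)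

/-- The Frobenius congruence `f(X)^q ≡ f(X^q)` modulo `p`, where `q` is a power of `p`. -/
theorem dvd_expand_sub_pow (f : MvPowerSeries (Fin 2) ℤ_[p]) (k : ℕ) (hk : p ^ k ≠ 0) :
    (p : MvPowerSeries (Fin 2) ℤ_[p]) ∣ expand (p ^ k) hk f - f ^ p ^ k := by
  have h0 : map (PadicInt.toZMod (p := p)) (expand (p ^ k) hk f - f ^ p ^ k) = 0 := by
    -- On the coefficient field $\mathbb F_p$ Frobenius is the identity, so modulo $p$ raising to
    -- the power $p^k$ only expands the variables.
    have hF : iterateFrobenius (ZMod p) p k = RingHom.id _ := Subsingleton.elim _ _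
    have := map_iterateFrobenius_expand p (Fact.out : p.Prime).ne_zero
      (map (PadicInt.toZMod (p := p)) f) k
    rw [hF, map_id, RingHom.id_apply] at this
    rw [map_sub, map_expand, map_pow, this, sub_self]
  have h1 : ∀ d, ∃ c : ℤ_[p], coeff d (expand (p ^ k) hk f - f ^ p ^ k) = p * c := by
    intro d
    have h2 := congrArg (coeff d) h0
    rw [coeff_map, map_zero, ← RingHom.mem_ker, PadicInt.ker_toZMod,
      PadicInt.maximalIdeal_eq_span_p, Ideal.mem_span_singleton] at h2
    exact h2
  choose c hc using h1
  obtain ⟨g, hg⟩ := exists_coeff_eq c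
  refine ⟨g, ?_⟩
  ext d
  rw [hc, ← map_natCast (C (σ := Fin 2) (R := ℤ_[p])), coeff_C_mul, hg]

end Integrality

/-! ### The functional equation lemma -/

section FunctionalEquation

variable {p : ℕ} [Fact p.Prime] {h : Fin 2 → ℕ+} {L : Fin 2 → MvPowerSeries (Fin 2) ℚ_[p]}

theorem prime_pow_ne_zero (k : ℕ) : p ^ k ≠ 0 := pow_ne_zero _ (Fact.out : p.Prime).ne_zero

/-- The functional equation `L_i(X) = x_i + p⁻¹ L_{i+1}(X^{p^{h_i}})`, indices modulo two, for a
pair of power series without constant term. -/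
structure FunctionalEquation (h : Fin 2 → ℕ+) (L : Fin 2 → MvPowerSeries (Fin 2) ℚ_[p]) :
    Prop where
  one_le_order : ∀ i, 1 ≤ (L i).order
  eq : ∀ i, L i = X i + (p : ℚ_[p])⁻¹ • expand (p ^ (h i : ℕ)) (prime_pow_ne_zero _) (L (i + 1))

theorem one_le_order_pow {K : Type*} [Field K] {f : MvPowerSeries (Fin 2) K} (hf : 1 ≤ f.order) {k : ℕ}
    (hk : k ≠ 0) : 1 ≤ (f ^ k).order := by
  rw [one_le_order_iff_constCoeff_eq_zero] at hf ⊢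
  rw [map_pow, hf, zero_pow hk]

/-- The functional equation after substitution. -/
theorem FunctionalEquation.subst (hL : FunctionalEquation h L)
    {a : Fin 2 → MvPowerSeries (Fin 2) ℚ_[p]} (ha : ∀ i, 1 ≤ (a i).order) (i : Fin 2) :
    (L i).subst a = a i + (p : ℚ_[p])⁻¹ • (L (i + 1)).subst fun j => a j ^ p ^ (h i : ℕ) := by
  have hs := hasSubst_of_order ha
  conv_lhs => rw [hL.eq i]
  rw [subst_add hs, subst_X hs, subst_smul hs, expand, substAlgHom_apply,
    subst_comp_subst_apply (HasSubst.X_pow (prime_pow_ne_zero _)) hs]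
  simp_rw [subst_pow hs, subst_X hs]

/-- `L(a) ≡ L(b)` modulo `p` if `a ≡ b` modulo `p`; more generally
`L(a^{p^k}) ≡ L(b^{p^k})` modulo `p^{k+1}`. -/
theorem FunctionalEquation.norm_coeff_subst_sub_le (hL : FunctionalEquation h L)
    {a b : Fin 2 → MvPowerSeries (Fin 2) ℤ_[p]} (ha : ∀ i, constantCoeff (a i) = 0)
    (hb : ∀ i, constantCoeff (b i) = 0)
    (hab : ∀ i, (p : MvPowerSeries (Fin 2) ℤ_[p]) ∣ a i - b i) (k : ℕ) (i : Fin 2)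
    (d : Fin 2 →₀ ℕ) :
    ‖coeff d ((L i).subst (fun j => ofInt (a j) ^ p ^ k) -
      (L i).subst fun j => ofInt (b j) ^ p ^ k)‖ ≤ ‖(p : ℚ_[p])‖ ^ (k + 1) := by
  have hp := (Fact.out : p.Prime)
  have hord : ∀ c : Fin 2 → MvPowerSeries (Fin 2) ℤ_[p], (∀ i, constantCoeff (c i) = 0) →
      ∀ k i, ((p ^ k : ℕ) : ℕ∞) ≤ (ofInt (c i) ^ p ^ k).order := by
    intro c hc k i
    exact le_order_pow_of_constantCoeff_eq_zero _ (by simp [hc])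
  have hord1 : ∀ c : Fin 2 → MvPowerSeries (Fin 2) ℤ_[p], (∀ i, constantCoeff (c i) = 0) →
      ∀ k i, 1 ≤ (ofInt (c i) ^ p ^ k).order := fun c hc k i =>
    le_trans (by exact_mod_cast Nat.one_le_pow _ _ hp.pos) (hord c hc k i)
  -- The functional equation trades `k` for the larger exponent `k + h i`. The induction stops once
  -- `k` exceeds the degree of `d`: both series then have order at least $p^k>\deg d$, and their
  -- coefficients at `d` vanish.
  suffices H : ∀ M k i, d.degree + 1 ≤ k + M →
      ‖coeff d ((L i).subst (fun j => ofInt (a j) ^ p ^ k) -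
        (L i).subst fun j => ofInt (b j) ^ p ^ k)‖ ≤ ‖(p : ℚ_[p])‖ ^ (k + 1) from
    H (d.degree + 1) k i (by omega)
  intro M
  induction M with
  | zero =>
    intro k i hk
    have hz : ∀ c : Fin 2 → MvPowerSeries (Fin 2) ℤ_[p], (∀ i, constantCoeff (c i) = 0) →
        coeff d ((L i).subst fun j => ofInt (c j) ^ p ^ k) = 0 := by
      intro c hc
      apply coeff_of_lt_order
      refine lt_of_lt_of_le ?_ (le_order_subst (hasSubst_of_order (hord1 c hc k)) _)
      have h1 : ((p ^ k : ℕ) : ℕ∞) ≤ ⨅ j, (ofInt (c j) ^ p ^ k).order := le_iInf (hord c hc k)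
      have h2 : ((p ^ k : ℕ) : ℕ∞) * 1 ≤ (⨅ j, (ofInt (c j) ^ p ^ k).order) * (L i).order :=
        mul_le_mul' h1 (hL.one_le_order i)
      rw [mul_one] at h2
      refine lt_of_lt_of_le ?_ h2
      have := Nat.lt_pow_self hp.one_lt (n := k)
      exact_mod_cast (by omega)
    rw [map_sub, hz a ha, hz b hb]
    simp
  | succ M ih =>
    intro k i hk
    rw [hL.subst (hord1 a ha k), hL.subst (hord1 b hb k)]
    simp_rw [← pow_mul, ← pow_add]
    rw [add_sub_add_comm, ← smul_sub, map_add]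
    refine (Padic.nonarchimedean _ _).trans (max_le ?_ ?_)
    · rw [← map_pow, ← map_pow, ← map_sub]
      exact norm_coeff_le_of_dvd (dvd_sub_pow_of_dvd_sub (hab i) k) d
    · have h1 := (h i).pos
      have h2 := ih (k + h i) (i + 1) (by omega)
      rw [coeff_smul, norm_mul, norm_inv]
      have h3 : 0 < ‖(p : ℚ_[p])‖ := norm_pos_iff.mpr (by exact_mod_cast hp.ne_zero)
      rw [inv_mul_le_iff₀ h3, ← pow_succ']
      refine h2.trans (pow_le_pow_of_le_one h3.le ?_ (by omega))
      exact Padic.norm_p_lt_one.le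

theorem FunctionalEquation.one_lt_prime_pow (i : Fin 2) : 2 ≤ p ^ (h i : ℕ) :=
  (Fact.out : p.Prime).two_le.trans (Nat.le_self_pow (h i).ne_zero p)

theorem FunctionalEquation.two_le_order_sub_X (hL : FunctionalEquation h L) (i : Fin 2) :
    2 ≤ (L i - X i).order := by
  have := order_expand_step p le_rfl (h i) (by simpa using hL.one_le_order (i + 1)) (p : ℚ_[p])⁻¹
  rw [← sub_eq_iff_eq_add'.mpr (hL.eq i)] at this
  exact this

theorem FunctionalEquation.le_order_subst_sub_subst (hL : FunctionalEquation h L)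
    {a b : Fin 2 → MvPowerSeries (Fin 2) ℚ_[p]} {n : ℕ}
    (ha : ∀ i, 1 ≤ (a i).order) (hb : ∀ i, 1 ≤ (b i).order)
    (hab : ∀ i, (n : ℕ∞) ≤ (a i - b i).order) (i : Fin 2) :
    (n : ℕ∞) ≤ ((L i).subst a - (L i).subst b).order := by
  have hN := order_subst_sub_subst (hL.two_le_order_sub_X i) ha hb hab
  have sa := hasSubst_of_order ha
  have sb := hasSubst_of_order hb
  rw [subst_sub sa, subst_sub sb, subst_X sa, subst_X sb] at hN
  have e : (L i).subst a - (L i).subst b =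
      ((L i).subst a - a i - ((L i).subst b - b i)) + (a i - b i) := by ring
  rw [e]
  exact le_order_add (le_trans (by exact_mod_cast Nat.le_succ n) hN) (hab i)

/-- The map whose fixed point is `L⁻¹(c L(X))`. -/
noncomputable def endoStep (h : Fin 2 → ℕ+) (L : Fin 2 → MvPowerSeries (Fin 2) ℚ_[p]) (c : ℕ)
    (a : Fin 2 → MvPowerSeries (Fin 2) ℚ_[p]) (i : Fin 2) : MvPowerSeries (Fin 2) ℚ_[p] :=
  c • X i + (p : ℚ_[p])⁻¹ •
    ((L (i + 1)).subst (fun j => expand (p ^ (h i : ℕ)) (prime_pow_ne_zero _) (a j)) -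
      (L (i + 1)).subst fun j => a j ^ p ^ (h i : ℕ))

/-- Expand both sides of $L_i(G)=cL_i$ by the functional equation and use
$cL_{i+1}(X^q)=L_{i+1}(G(X^q))$. -/
theorem FunctionalEquation.endoStep_eq (hL : FunctionalEquation h L) {c : ℕ}
    {G : Fin 2 → MvPowerSeries (Fin 2) ℚ_[p]} (hG : ∀ i, 1 ≤ (G i).order)
    (hLG : ∀ i, (L i).subst G = c • L i) : endoStep h L c G = G := by
  funext i
  have h1 := hL.subst hG i
  have h2 := expand_subst (p ^ (h i : ℕ)) (prime_pow_ne_zero _) (hasSubst_of_order hG)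
    (φ := L (i + 1))
  rw [hLG, map_nsmul] at h2
  have h3 := congrArg (c • ·) (hL.eq i)
  simp only [smul_add] at h3
  rw [hLG, h3, smul_comm c, h2] at h1
  rw [endoStep, smul_sub]
  linear_combination h1

theorem one_le_order_expand {f : MvPowerSeries (Fin 2) ℚ_[p]} (hf : 1 ≤ f.order) {k : ℕ}
    (hk : k ≠ 0) : 1 ≤ (expand k hk f).order := by
  rw [one_le_order_iff_constCoeff_eq_zero] at hf ⊢
  rw [constantCoeff_expand, hf]

/-- With $q\ge 2$, expansion multiplies the order of a difference by $q$, and taking $q$-th powers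
adds at least $q-1$ to it. Substitution into $L$ loses nothing. -/
theorem FunctionalEquation.le_order_endoStep_sub (hL : FunctionalEquation h L) {c n : ℕ}
    (hn : 1 ≤ n) {a b : Fin 2 → MvPowerSeries (Fin 2) ℚ_[p]}
    (ha : ∀ i, 1 ≤ (a i).order) (hb : ∀ i, 1 ≤ (b i).order)
    (hab : ∀ i, (n : ℕ∞) ≤ (a i - b i).order) (i : Fin 2) :
    ((n + 1 : ℕ) : ℕ∞) ≤ (endoStep h L c a i - endoStep h L c b i).order := by
  have hq := FunctionalEquation.one_lt_prime_pow (p := p) (h := h) i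
  have h0 := prime_pow_ne_zero (p := p) (h i)
  have hE := hL.le_order_subst_sub_subst (n := n + 1)
    (fun j => one_le_order_expand (ha j) h0) (fun j => one_le_order_expand (hb j) h0)
    (fun j => by
      rw [← map_sub, order_expand]
      calc ((n + 1 : ℕ) : ℕ∞) ≤ ((p ^ (h i : ℕ) * n : ℕ) : ℕ∞) := by
            exact_mod_cast (by nlinarith)
        _ = (p ^ (h i : ℕ)) • (n : ℕ∞) := by simp
        _ ≤ _ := by gcongr; exact hab j) (i + 1)
  have hP := hL.le_order_subst_sub_subst (n := n + 1)
    (fun j => one_le_order_pow (ha j) h0) (fun j => one_le_order_pow (hb j) h0)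
    (fun j => by
      have := order_pow_sub_pow (ha j) (hb j) (hab j) (p ^ (h i : ℕ) - 1)
      rw [Nat.sub_add_cancel (by omega)] at this
      exact le_trans (by exact_mod_cast (by omega)) this) (i + 1)
  rw [endoStep, endoStep, add_sub_add_left_eq_sub, ← smul_sub, sub_sub_sub_comm]
  exact (le_order_sub hE hP).trans le_order_smul

theorem FunctionalEquation.one_le_order_endoStep (hL : FunctionalEquation h L) {c : ℕ}
    {a : Fin 2 → MvPowerSeries (Fin 2) ℚ_[p]} (ha : ∀ i, 1 ≤ (a i).order) (i : Fin 2) :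
    1 ≤ (endoStep h L c a i).order := by
  have h0 := prime_pow_ne_zero (p := p) (h i)
  refine le_order_add ?_ ((le_order_sub ?_ ?_).trans le_order_smul)
  · rw [one_le_order_iff_constCoeff_eq_zero]
    simp
  · exact le_order_subst_of (hL.one_le_order _) fun j => one_le_order_expand (ha j) h0
  · exact le_order_subst_of (hL.one_le_order _) fun j => one_le_order_pow (ha j) h0

/-- `endoStep` preserves power series with coefficients in `ℤ_p`. -/
theorem FunctionalEquation.exists_ofInt_eq_endoStep (hL : FunctionalEquation h L) (c : ℕ)
    {a : Fin 2 → MvPowerSeries (Fin 2) ℤ_[p]} (ha : ∀ i, constantCoeff (a i) = 0) (i : Fin 2) :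
    ∃ g, ofInt g = endoStep h L c (fun j => ofInt (a j)) i := by
  apply exists_ofInt_eq
  intro d
  have h0 := prime_pow_ne_zero (p := p) (h i)
  -- Case $k=0$ for $a(X^q)\equiv a(X)^q$: the difference of the two values of $L_{i+1}$ is
  -- divisible by $p$, which cancels $p^{-1}$.
  have h1 := hL.norm_coeff_subst_sub_le (a := fun j => expand (p ^ (h i : ℕ)) h0 (a j))
    (b := fun j => a j ^ p ^ (h i : ℕ)) (fun j => by simp [ha]) (fun j => by rw [map_pow, ha, zero_pow h0])
    (fun j => dvd_expand_sub_pow (a j) _ h0) 0 (i + 1) d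
  simp only [pow_zero, pow_one, zero_add, map_expand, map_pow] at h1
  rw [endoStep, map_add]
  refine (Padic.nonarchimedean _ _).trans (max_le ?_ ?_)
  · have : c • (X i : MvPowerSeries (Fin 2) ℚ_[p]) = ofInt (c • X i) := by
      rw [map_nsmul, map_X]
    rw [this]
    exact norm_coeff_ofInt_le_one _ d
  · have h3 : 0 < ‖(p : ℚ_[p])‖ :=
      norm_pos_iff.mpr (by exact_mod_cast (Fact.out : p.Prime).ne_zero)
    rw [coeff_smul, norm_mul, norm_inv, inv_mul_le_iff₀ h3, mul_one]
    exact h1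

/-- Integrality of `L⁻¹(c L(X))`: a special case of Hazewinkel's functional equation lemma. -/
theorem FunctionalEquation.exists_ofInt_eq_of_subst_eq_nsmul (hL : FunctionalEquation h L) {c : ℕ}
    {G : Fin 2 → MvPowerSeries (Fin 2) ℚ_[p]} (hG : ∀ i, 1 ≤ (G i).order)
    (hLG : ∀ i, (L i).subst G = c • L i) :
    ∃ g : Fin 2 → MvPowerSeries (Fin 2) ℤ_[p], ∀ i, ofInt (g i) = G i := by
  -- Integral approximations of `G`: the iterates of `endoStep` from `0`. Each coefficient of `G` is
  -- a coefficient of one of them.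
  have H : ∀ n : ℕ, ∃ a : Fin 2 → MvPowerSeries (Fin 2) ℤ_[p], (∀ i, constantCoeff (a i) = 0) ∧
      ∀ i, ((n + 1 : ℕ) : ℕ∞) ≤ (ofInt (a i) - G i).order := by
    intro n
    induction n with
    | zero =>
      refine ⟨0, fun i => by simp, fun i => ?_⟩
      rw [Pi.zero_apply, map_zero, zero_sub, order_neg]
      simpa using hG i
    | succ n ih =>
      obtain ⟨a, ha, hn⟩ := ih
      have ha1 : ∀ i, 1 ≤ (ofInt (a i)).order := fun i => by
        rw [one_le_order_iff_constCoeff_eq_zero, constantCoeff_map, ha, map_zero]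
      choose b hb using hL.exists_ofInt_eq_endoStep c ha
      refine ⟨b, fun i => ?_, fun i => ?_⟩
      · have := one_le_order_iff_constCoeff_eq_zero.mp (hL.one_le_order_endoStep (c := c) ha1 i)
        rw [← hb, constantCoeff_map] at this
        exact Subtype.coe_injective this
      · have := hL.le_order_endoStep_sub (c := c) (by omega) ha1 hG hn i
        rwa [hL.endoStep_eq hG hLG, ← hb] at this
  choose g hg using fun i => exists_ofInt_eq (f := G i) fun d => by
    obtain ⟨a, -, hn⟩ := H d.degree
    have := coeff_of_lt_order (lt_of_lt_of_le (by exact_mod_cast Nat.lt_succ_self _) (hn i))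
    rw [map_sub, sub_eq_zero] at this
    rw [← this]
    exact norm_coeff_ofInt_le_one _ d
  exact ⟨g, hg⟩

end FunctionalEquation

/-! ### Evaluation on the open polydisc -/

section Evaluation

variable {p : ℕ} [Fact p.Prime] {α : Fin 2 → PadicAlgCl p}

instance nonarchimedeanRing_padicAlgCl : NonarchimedeanRing (PadicAlgCl p) where
  is_nonarchimedean := NonarchimedeanAddGroup.is_nonarchimedean

theorem tendsto_degree_cofinite :
    Filter.Tendsto (fun d : Fin 2 →₀ ℕ => d.degree) Filter.cofinite Filter.atTop := by
  rw [Filter.tendsto_atTop]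
  intro n
  rw [Filter.eventually_cofinite]
  simpa using Finsupp.finite_of_degree_lt (σ := Fin 2) n

theorem tendsto_termAt_ofInt (hα : ∀ i, ‖α i‖ < 1) (f : MvPowerSeries (Fin 2) ℤ_[p]) :
    Filter.Tendsto (termAt (ofInt f) α) Filter.cofinite (nhds 0) := by
  obtain ⟨r, hr0, hr1, hr⟩ : ∃ r : ℝ, 0 ≤ r ∧ r < 1 ∧ ∀ i, ‖α i‖ ≤ r :=
    ⟨max ‖α 0‖ ‖α 1‖, le_max_of_le_left (norm_nonneg _), max_lt (hα 0) (hα 1), fun i => by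
      fin_cases i
      · exact le_max_left _ _
      · exact le_max_right _ _⟩
  refine squeeze_zero_norm (a := fun d => r ^ d.degree) (fun d => ?_)
    (Filter.Tendsto.comp (f := fun d : Fin 2 →₀ ℕ => d.degree)
      (tendsto_pow_atTop_nhds_zero_of_lt_one hr0 hr1) tendsto_degree_cofinite)
  have h1 : ‖algebraMap ℚ_[p] (PadicAlgCl p) (coeff d (ofInt f))‖ ≤ 1 := by
    rw [norm_algebraMap']
    exact norm_coeff_ofInt_le_one f d
  rw [termAt, norm_mul, Finsupp.degree_eq_sum, ← Finset.prod_pow_eq_pow_sum, norm_prod]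
  refine (mul_le_of_le_one_left (by positivity) h1).trans ?_
  refine Finset.prod_le_prod (fun i _ => norm_nonneg _) fun i _ => ?_
  rw [norm_pow]
  exact pow_le_pow_left₀ (norm_nonneg _) (hr i) _

/-- $\overline{\mathbb Q}_p$ is not complete, but all terms lie in $\mathbb Q_p[\alpha_1,\alpha_2]$,
which is finite-dimensional and hence complete. There, terms tending to zero suffice for
summability. -/
theorem summable_termAt_ofInt (hα : ∀ i, ‖α i‖ < 1) (f : MvPowerSeries (Fin 2) ℤ_[p]) :
    Summable (termAt (ofInt f) α) := by
  let V : Submodule ℚ_[p] (PadicAlgCl p) :=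
    Subalgebra.toSubmodule (Algebra.adjoin ℚ_[p] (Set.range α))
  have hV : FiniteDimensional ℚ_[p] V := Module.Finite.iff_fg.mpr
    (fg_adjoin_of_finite (Set.finite_range α) fun x _ => Algebra.IsIntegral.isIntegral x)
  have hc : CompleteSpace V := FiniteDimensional.complete ℚ_[p] V
  have hmem : ∀ d, termAt (ofInt f) α d ∈ V := by
    intro d
    refine Subalgebra.mul_mem _ (Subalgebra.algebraMap_mem _ _)
      (Subalgebra.prod_mem _ fun i _ => Subalgebra.pow_mem _ ?_ _)
    exact Algebra.subset_adjoin (Set.mem_range_self i)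
  have h1 : Filter.Tendsto (fun d => (⟨termAt (ofInt f) α d, hmem d⟩ : V)) Filter.cofinite
      (nhds 0) := by
    rw [tendsto_subtype_rng]
    exact tendsto_termAt_ofInt hα f
  have h2 := NonarchimedeanAddGroup.summable_of_tendsto_cofinite_zero h1
  exact h2.map V.subtype continuous_subtype_val

theorem termAt_ofInt_add (f g : MvPowerSeries (Fin 2) ℤ_[p]) (d : Fin 2 →₀ ℕ) :
    termAt (ofInt (f + g)) α d = termAt (ofInt f) α d + termAt (ofInt g) α d := by
  simp only [termAt, map_add, add_mul]

theorem termAt_ofInt_mul (f g : MvPowerSeries (Fin 2) ℤ_[p]) (d : Fin 2 →₀ ℕ) :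
    termAt (ofInt (f * g)) α d =
      ∑ x ∈ Finset.HasAntidiagonal.antidiagonal d, termAt (ofInt f) α x.1 * termAt (ofInt g) α x.2 := by
  rw [termAt, map_mul, coeff_mul, map_sum, Finset.sum_mul]
  refine Finset.sum_congr rfl fun x hx => ?_
  rw [← Finset.HasAntidiagonal.mem_antidiagonal.mp hx, map_mul, termAt, termAt]
  simp only [Finsupp.add_apply, pow_add, Finset.prod_mul_distrib]
  ring

theorem termAt_C (c : ℚ_[p]) {d : Fin 2 →₀ ℕ} (hd : d ≠ 0) : termAt (C c) α d = 0 := by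
  rw [termAt, coeff_C_of_ne_zero hd, map_zero, zero_mul]

theorem evalAt_C (c : ℚ_[p]) : evalAt (C c) α = algebraMap ℚ_[p] (PadicAlgCl p) c := by
  rw [evalAt, tsum_eq_single 0 fun d hd => termAt_C c hd]
  simp [termAt]

/-- The evaluation of power series with coefficients in `ℤ_p` at a point of the open polydisc. -/
noncomputable def evalHom (hα : ∀ i, ‖α i‖ < 1) :
    MvPowerSeries (Fin 2) ℤ_[p] →+* PadicAlgCl p where
  toFun f := evalAt (ofInt f) α
  map_one' := by rw [map_one, ← map_one C, evalAt_C, map_one]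
  map_zero' := by rw [map_zero, ← map_zero C, evalAt_C, map_zero]
  map_add' f g := by
    simp only [evalAt, termAt_ofInt_add]
    exact (summable_termAt_ofInt hα f).tsum_add (summable_termAt_ofInt hα g)
  map_mul' f g := by
    have hf := summable_termAt_ofInt hα f
    have hg := summable_termAt_ofInt hα g
    simp only [evalAt, termAt_ofInt_mul]
    exact (hf.tsum_mul_tsum_eq_tsum_sum_antidiagonal hg (hf.mul_of_nonarchimedean hg)).symm

theorem evalHom_apply (hα : ∀ i, ‖α i‖ < 1) (f : MvPowerSeries (Fin 2) ℤ_[p]) :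
    evalHom hα f = evalAt (ofInt f) α := rfl

theorem hasseDeriv_zero (f : MvPowerSeries (Fin 2) ℚ_[p]) : hasseDeriv 0 f = f := by
  ext d
  rw [coeff_apply, hasseDeriv]
  simp

theorem hasseDeriv_single (j : Fin 2) (f : MvPowerSeries (Fin 2) ℚ_[p]) :
    hasseDeriv (Finsupp.single j 1) f = pderiv ℚ_[p] j f := by
  ext d
  rw [coeff_pderiv, coeff_apply, hasseDeriv, mul_comm]
  congr 1
  fin_cases j <;> simp

theorem coeff_single_taylorAt (f : MvPowerSeries (Fin 2) ℚ_[p]) (j : Fin 2) :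
    coeff (Finsupp.single j 1) (taylorAt f α) = evalAt (pderiv ℚ_[p] j f) α := by
  rw [coeff_apply, taylorAt, hasseDeriv_single]

/-- A solution at which the Jacobian matrix is invertible has multiplicity one. -/
theorem IsSolution.multiplicity_eq_one {f : Fin 2 → MvPowerSeries (Fin 2) ℚ_[p]}
    (hα : IsSolution f α) (hJ : IsUnit (jacobianAt f α)) : multiplicity f α = 1 := by
  apply finrank_quotient_span_eq_one
  · intro i
    rw [← coeff_zero_eq_constantCoeff_apply, coeff_apply, taylorAt, hasseDeriv_zero, evalAt,
      (hα.2 i).tsum_eq]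
  · simp only [coeff_single_taylorAt]
    exact hJ

end Evaluation

/-! ### Invertibility of the Jacobian matrix -/

section Jacobian

variable {p : ℕ} [Fact p.Prime] {h : Fin 2 → ℕ+} {L : Fin 2 → MvPowerSeries (Fin 2) ℚ_[p]}

/-- These are the coefficients of $x_j\,\partial L_i/\partial x_j$. Induction on the degree: a
monomial of $L_{i+1}(X^q)$ has exponent $qe$, and the factor $q$ in $(qe)_j$ compensates $p^{-1}$.
-/
theorem FunctionalEquation.norm_mul_coeff_le_one (hL : FunctionalEquation h L) (j i : Fin 2)
    (d : Fin 2 →₀ ℕ) : ‖(d j : ℚ_[p]) * coeff d (L i)‖ ≤ 1 := by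
  have hp := (Fact.out : p.Prime)
  suffices H : ∀ n (i : Fin 2) (d : Fin 2 →₀ ℕ), d.degree ≤ n →
      ‖(d j : ℚ_[p]) * coeff d (L i)‖ ≤ 1 from H _ i d le_rfl
  intro n
  induction n with
  | zero =>
    intro i d hd
    have : d = 0 := by
      rw [← Finsupp.degree_eq_zero_iff]
      omega
    simp [this]
  | succ n ih =>
    intro i d hd
    classical
    have hq := FunctionalEquation.one_lt_prime_pow (p := p) (h := h) i
    have h0 := prime_pow_ne_zero (p := p) (h i)
    rw [hL.eq i, map_add, mul_add, coeff_smul]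
    refine (Padic.nonarchimedean _ _).trans (max_le ?_ ?_)
    · rw [coeff_X]
      split_ifs
      · rw [mul_one]
        exact_mod_cast Padic.norm_int_le_one (d j : ℤ)
      · simp
    · by_cases hdvd : ∃ e : Fin 2 →₀ ℕ, d = p ^ (h i : ℕ) • e
      · obtain ⟨e, rfl⟩ := hdvd
        rw [coeff_expand_smul]
        have he : e.degree ≤ n := by
          rw [map_nsmul, smul_eq_mul] at hd
          nlinarith [Nat.zero_le e.degree]
        have hpp : (p : ℚ_[p]) ^ (h i : ℕ) * (p : ℚ_[p])⁻¹ = p ^ ((h i : ℕ) - 1) := by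
          have hp0 : (p : ℚ_[p]) ≠ 0 := by exact_mod_cast hp.ne_zero
          rw [mul_inv_eq_iff_eq_mul₀ hp0, ← pow_succ, Nat.sub_add_cancel (h i).pos]
        have e1 : (((p ^ (h i : ℕ) • e) j : ℕ) : ℚ_[p]) * ((p : ℚ_[p])⁻¹ * coeff e (L (i + 1))) =
            p ^ ((h i : ℕ) - 1) * (e j * coeff e (L (i + 1))) := by
          rw [← hpp, Finsupp.smul_apply, smul_eq_mul]
          push_cast
          ring
        rw [e1, norm_mul, norm_pow]
        exact mul_le_one₀ (pow_le_one₀ (norm_nonneg _) Padic.norm_p_lt_one.le) (norm_nonneg _)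
          (ih _ _ he)
      · have : ∃ l, ¬ p ^ (h i : ℕ) ∣ d l := by
          by_contra! hc
          choose e he using hc
          exact hdvd ⟨Finsupp.equivFunOnFinite.symm e, by ext l; simp [he]⟩
        obtain ⟨l, hl⟩ := this
        rw [coeff_expand_of_not_dvd _ _ _ hl]
        simp

theorem FunctionalEquation.exists_ofInt_eq_pderiv (hL : FunctionalEquation h L) (i j : Fin 2) :
    ∃ u, ofInt u = pderiv ℚ_[p] j (L i) := by
  apply exists_ofInt_eq
  intro d
  have := hL.norm_mul_coeff_le_one j i (d + Finsupp.single j 1)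
  rw [coeff_pderiv, mul_comm]
  simpa using this

theorem FunctionalEquation.constantCoeff_pderiv (hL : FunctionalEquation h L) (i j : Fin 2) :
    constantCoeff (pderiv ℚ_[p] j (L i)) = (1 : Matrix (Fin 2) (Fin 2) ℚ_[p]) i j := by
  have h1 : pderiv ℚ_[p] j (L i) = pderiv ℚ_[p] j (X i) + pderiv ℚ_[p] j (L i - X i) := by
    rw [← map_add, add_sub_cancel]
  have h2 := pderiv_order_le (n := 1) j (hL.two_le_order_sub_X i)
  rw [Nat.cast_one, one_le_order_iff_constCoeff_eq_zero] at h2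
  rw [h1, map_add, h2, add_zero, pderiv_X, Matrix.one_apply, Pi.single_apply]
  split_ifs <;> simp

theorem constantCoeff_subst_of_order {K : Type*} [Field K] (f : MvPowerSeries (Fin 2) K)
    {a : Fin 2 → MvPowerSeries (Fin 2) K} (ha : ∀ i, 1 ≤ (a i).order) :
    constantCoeff (f.subst a) = constantCoeff f := by
  have hs := hasSubst_of_order ha
  have h0 : constantCoeff ((f - C (constantCoeff f)).subst a) = 0 :=
    constantCoeff_subst_eq_zero hs
      (fun i => one_le_order_iff_constCoeff_eq_zero.mp (ha i)) (by simp)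
  rw [subst_sub hs, map_sub, sub_eq_zero] at h0
  rw [h0, show (C (constantCoeff f)).subst a = C (constantCoeff f) from subst_C (S := K) _,
    constantCoeff_C]

/-- The Jacobian matrix of `L⁻¹(c L(X))` is invertible on the open polydisc. -/
theorem FunctionalEquation.isUnit_jacobianAt (hL : FunctionalEquation h L) {c : ℕ} (hc : c ≠ 0)
    {G : Fin 2 → MvPowerSeries (Fin 2) ℚ_[p]} (hG : ∀ i, 1 ≤ (G i).order)
    (hLG : ∀ i, (L i).subst G = c • L i) {α : Fin 2 → PadicAlgCl p} (hα : ∀ i, ‖α i‖ < 1) :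
    IsUnit (jacobianAt G α) := by
  obtain ⟨g, hg⟩ := hL.exists_ofInt_eq_of_subst_eq_nsmul hG hLG
  choose u hu using hL.exists_ofInt_eq_pderiv
  have hgc : ∀ i, constantCoeff (g i) = 0 := fun i => by
    have := one_le_order_iff_constCoeff_eq_zero.mp (hG i)
    rw [← hg, constantCoeff_map] at this
    exact Subtype.coe_injective this
  have hgs : HasSubst g := hasSubst_of_constantCoeff_zero hgc
  set U : Matrix (Fin 2) (Fin 2) (MvPowerSeries (Fin 2) ℤ_[p]) := Matrix.of u with hU
  set W : Matrix (Fin 2) (Fin 2) (MvPowerSeries (Fin 2) ℤ_[p]) :=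
    Matrix.of fun i j => (u i j).subst g with hW
  set D : Matrix (Fin 2) (Fin 2) (MvPowerSeries (Fin 2) ℤ_[p]) :=
    Matrix.of fun i j => pderiv ℤ_[p] j (g i) with hD
  have hWG : ∀ i j, ofInt (W i j) = (pderiv ℚ_[p] j (L i)).subst G := by
    intro i j
    rw [hW, Matrix.of_apply, map_subst hgs]
    congr 1
    · funext i; exact hg i
    · exact hu i j
  -- Differentiate $L(G)=cL$ over $\mathbb Q_p$, where $L$ lives, and descend to $\mathbb Z_p$ by
  -- injectivity of the extension of scalars.
  have chain : W * D = c • U := by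
    ext1 i j
    apply ofInt_injective
    have := congrArg (pderiv ℚ_[p] j) (hLG i)
    rw [pderiv_subst _ hG, map_nsmul, ← hu] at this
    rw [Matrix.mul_apply, map_sum, Matrix.smul_apply, map_nsmul, hU, Matrix.of_apply, ← this]
    refine Finset.sum_congr rfl fun l _ => ?_
    rw [map_mul, hWG, hD, Matrix.of_apply, ← pderiv_ofInt, hg]
  -- An integral matrix with identity constant term has determinant with constant term 1, hence is
  -- invertible; ring homomorphisms preserve this.
  have hone : ∀ M : Matrix (Fin 2) (Fin 2) (MvPowerSeries (Fin 2) ℤ_[p]),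
      (∀ i j, constantCoeff (ofInt (M i j)) = (1 : Matrix (Fin 2) (Fin 2) ℚ_[p]) i j) →
      IsUnit ((evalHom hα).mapMatrix M) := by
    intro M hM
    apply RingHom.isUnit_map
    rw [Matrix.isUnit_iff_isUnit_det, isUnit_iff_constantCoeff, RingHom.map_det]
    have : (constantCoeff (σ := Fin 2) (R := ℤ_[p])).mapMatrix M = 1 := by
      ext i j
      have := hM i j
      rw [constantCoeff_map] at this
      rw [RingHom.mapMatrix_apply, Matrix.map_apply]
      apply Subtype.coe_injective
      refine Eq.trans this ?_
      rw [Matrix.one_apply, Matrix.one_apply]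
      split_ifs <;> rfl
    rw [this, Matrix.det_one]
    exact isUnit_one
  have hUu := hone U fun i j => by
    rw [hU, Matrix.of_apply, hu, hL.constantCoeff_pderiv]
  have hWu := hone W fun i j => by
    rw [hWG, constantCoeff_subst_of_order _ hG, hL.constantCoeff_pderiv]
  have hJ : jacobianAt G α = (evalHom hα).mapMatrix D := by
    ext i j
    rw [RingHom.mapMatrix_apply, Matrix.map_apply, evalHom_apply, hD, Matrix.of_apply,
      ← pderiv_ofInt, hg]
    rfl
  have hE := congrArg (evalHom hα).mapMatrix chain
  rw [map_mul, map_nsmul, ← hJ] at hE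
  rw [Matrix.isUnit_iff_isUnit_det, isUnit_iff_ne_zero] at hUu hWu ⊢
  -- A zero determinant would give $c^2\det U(\alpha)=0$, impossible in characteristic zero.
  intro h0
  have := congrArg Matrix.det hE
  rw [Matrix.det_mul, h0, mul_zero, ← Nat.cast_smul_eq_nsmul (PadicAlgCl p),
    Matrix.det_smul] at this
  exact mul_ne_zero (pow_ne_zero _ (Nat.cast_ne_zero.mpr hc)) hUu this.symm

end Jacobian

/-! ### The logarithm linearizes multiplication -/

section Multiplication

variable (p : ℕ) [Fact p.Prime] (h₁ h₂ : ℕ+)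

theorem functionalEquation_logarithm :
    FunctionalEquation ![h₁, h₂] (logarithm p h₁ h₂) where
  one_le_order i := one_le_order_iff_constCoeff_eq_zero.mpr
    ((isLogarithm_logarithm p h₁ h₂).constantCoeff_eq_zero p h₁ h₂ i)
  eq i := by
    obtain ⟨e0, e1⟩ := (isLogarithm_iff p h₁ h₂ _).mp (isLogarithm_logarithm p h₁ h₂)
    fin_cases i
    · exact e0
    · exact e1

/-- Since $L(F(X,Y))=L(X)+L(Y)$, each recursion step adds one copy of $L$. The order bound travels
along the induction to make the substitutions legitimate. -/
theorem logarithm_subst_mulMap (k : ℕ) :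
    (∀ i, 1 ≤ (mulMap (formalGroup p h₁ h₂) k i).order) ∧
    ∀ i, (logarithm p h₁ h₂ i).subst (mulMap (formalGroup p h₁ h₂) k) =
      k • logarithm p h₁ h₂ i := by
  have hL := functionalEquation_logarithm p h₁ h₂
  have hLc := fun i => one_le_order_iff_constCoeff_eq_zero.mp (hL.one_le_order i)
  obtain ⟨hM, hLM, -⟩ := isCompInverse_logarithmInv p h₁ h₂
  have hMs : HasSubst (logarithmInv p h₁ h₂) := hasSubst_of_constantCoeff_zero hM
  induction k using Nat.strong_induction_on with
  | _ k ih =>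
    match k with
    | 0 =>
      refine ⟨fun i => by simp [mulMap], fun i => ?_⟩
      rw [zero_smul]
      exact subst_zero_of_constantCoeff_zero (hLc i)
    | 1 =>
      refine ⟨fun i => one_le_order_X i, fun i => ?_⟩
      rw [one_smul]
      exact congrFun subst_self _
    | k + 2 =>
      obtain ⟨ho, hk⟩ := ih (k + 1) (by omega)
      set T : Fin 2 → MvPowerSeries (Fin 2 ⊕ Fin 2) ℚ_[p] := fun j =>
        (logarithm p h₁ h₂ j).subst
          (fun l => (X (Sum.inl l) : MvPowerSeries (Fin 2 ⊕ Fin 2) ℚ_[p])) +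
        (logarithm p h₁ h₂ j).subst
          (fun l => (X (Sum.inr l) : MvPowerSeries (Fin 2 ⊕ Fin 2) ℚ_[p])) with hT
      have sl : HasSubst fun l : Fin 2 => (X (Sum.inl l) : MvPowerSeries (Fin 2 ⊕ Fin 2) ℚ_[p]) :=
        hasSubst_of_constantCoeff_zero fun l => constantCoeff_X _
      have sr : HasSubst fun l : Fin 2 => (X (Sum.inr l) : MvPowerSeries (Fin 2 ⊕ Fin 2) ℚ_[p]) :=
        hasSubst_of_constantCoeff_zero fun l => constantCoeff_X _
      have hTc : ∀ j, constantCoeff (T j) = 0 := fun j => by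
        rw [hT, map_add,
          constantCoeff_subst_eq_zero sl (fun l => constantCoeff_X _) (hLc j),
          constantCoeff_subst_eq_zero sr (fun l => constantCoeff_X _) (hLc j), add_zero]
      have hTs : HasSubst T := hasSubst_of_constantCoeff_zero hTc
      set E : Fin 2 ⊕ Fin 2 → MvPowerSeries (Fin 2) ℚ_[p] :=
        Sum.elim (fun l => X l) (mulMap (formalGroup p h₁ h₂) (k + 1)) with hE
      have hEc : ∀ l, constantCoeff (E l) = 0 := by
        rintro (l | l)
        · exact constantCoeff_X l
        · exact one_le_order_iff_constCoeff_eq_zero.mp (ho l)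
      have hEs : HasSubst E := hasSubst_of_constantCoeff_zero hEc
      have hF : ∀ i, formalGroup p h₁ h₂ i = (logarithmInv p h₁ h₂ i).subst T := fun i => rfl
      have hFc : ∀ i, constantCoeff (formalGroup p h₁ h₂ i) = 0 := fun i => by
        rw [hF]
        exact constantCoeff_subst_eq_zero hTs hTc (hM i)
      have hFs : HasSubst (formalGroup p h₁ h₂) := hasSubst_of_constantCoeff_zero hFc
      refine ⟨fun i => ?_, fun i => ?_⟩
      · rw [one_le_order_iff_constCoeff_eq_zero]
        exact constantCoeff_subst_eq_zero hEs hEc (hFc i)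
      · have hLF : (logarithm p h₁ h₂ i).subst (formalGroup p h₁ h₂) = T i := by
          calc _ = ((logarithm p h₁ h₂ i).subst (logarithmInv p h₁ h₂)).subst T :=
                (subst_comp_subst_apply hMs hTs _).symm
            _ = T i := by rw [hLM, subst_X hTs]
        calc (logarithm p h₁ h₂ i).subst (mulMap (formalGroup p h₁ h₂) (k + 2))
            = ((logarithm p h₁ h₂ i).subst (formalGroup p h₁ h₂)).subst E :=
              (subst_comp_subst_apply hFs hEs _).symm
          _ = (logarithm p h₁ h₂ i).subst (fun l => X l) +
                (logarithm p h₁ h₂ i).subst (mulMap (formalGroup p h₁ h₂) (k + 1)) := by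
              rw [hLF, hT, subst_add hEs, subst_comp_subst_apply sl hEs,
                subst_comp_subst_apply sr hEs]
              simp_rw [subst_X hEs]
              rfl
          _ = (k + 2) • logarithm p h₁ h₂ i := by
              rw [hk, show (fun l => X l : Fin 2 → MvPowerSeries (Fin 2) ℚ_[p]) = X from rfl,
                subst_self, id, ← succ_nsmul']

end Multiplication

end LubinTate2

theorem theorem3p2 (p : ℕ) [Fact p.Prime] (h₁ h₂ : ℕ+) (hcop : Nat.Coprime h₁ h₂)
    (n : ℕ) (hn : 1 ≤ n) (α : Fin 2 → PadicAlgCl p)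
    (hα : LubinTate2.IsSolution
      (LubinTate2.mulMap (LubinTate2.formalGroup p h₁ h₂) (p ^ n)) α) :
    LubinTate2.multiplicity
        (LubinTate2.mulMap (LubinTate2.formalGroup p h₁ h₂) (p ^ n)) α = 1 ∧
      IsUnit (LubinTate2.jacobianAt
        (LubinTate2.mulMap (LubinTate2.formalGroup p h₁ h₂) p) α) := by
  have hL := LubinTate2.functionalEquation_logarithm p h₁ h₂
  have hp := (Fact.out : p.Prime).ne_zero
  -- Needed for two values of `k`: $p^n$ for the multiplicity, $p$ for the Jacobian statement. Only
  -- the position of `α` in the open polydisc enters.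
  have hJ : ∀ k, k ≠ 0 → IsUnit (LubinTate2.jacobianAt
      (LubinTate2.mulMap (LubinTate2.formalGroup p h₁ h₂) k) α) := fun k hk => by
    obtain ⟨ho, hk'⟩ := LubinTate2.logarithm_subst_mulMap p h₁ h₂ k
    exact hL.isUnit_jacobianAt hk ho hk' hα.1
  exact ⟨hα.multiplicity_eq_one (hJ _ (pow_ne_zero n hp)), hJ p hp⟩
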